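/- Let $a, b \in \mathbb{F}_2[z]$ be distinct, non-constant polynomials. Let $t_0 t_1 t_2 \ldots = abbabaab\ldots$ be the Thue--Morse word over $\{a,b\}$, defined by $t_0 = a$, $t_{2k} = t_k$, and $t_{2k+1} = a$ (resp. $b$) if $t_k = b$ (resp. $a$), for $k \ge 0$. Then the continued fraction $\xi_{a,b} = [0; t_0, t_1, t_2, \ldots] = [0; a, b, b, a, b, a, a, b, \ldots]$ converges in the field of power series $\mathbb{F}_2((z^{-1}))$, and, writing $'$ for the derivation of $\mathbb{F}_2((z^{-1}))$ with respect to $z$ (which extends the usual derivation of $\mathbb{F}_2[z]$), the following holds. (i) $\xi_{a,b}$ is differential-quadratic, that is, $\xi_{a,b}' = A\,\xi_{a,b}^2 + B\,\xi_{a,b} + C$ for some $A, B, C \in \mathbb{F}_2(z)$; more precisely, $x = \xi_{a,b}$ satisfies the Riccati equation $$[\,ab(a+b)\,x\,]' = (ab)'\,(1 + x^2).$$ (ii) $\xi_{a,b}$ is irrational (not in $\mathbb{F}_2(z)$) and it is not hyperquadratic: there are no integer $s \ge 1$ and no polynomials $A, B, C, D \in \mathbb{F}_2[z]$ with $AD -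 BC \neq 0$ such that $$\xi_{a,b} = \frac{A\,\xi_{a,b}^{2^s} + B}{C\,\xi_{a,b}^{2^s} + D}.$$ -/

import Mathlib

open Filter Topology
open scoped LaurentSeries Polynomial

noncomputable section

namespace ThueMorseCF

/-! The field `K((z⁻¹))` is realised as Mathlib's `K⸨X⸩`, where the series variable `X`
stands for `z⁻¹`; its topology is the `X`-adic one, that is, the one given by the degree in `z`.
A series `∑ aₙ z⁻ⁿ` is the element whose coefficient at `n : ℤ` is `aₙ`. -/

/-- The element `z = X⁻¹` of `K((z⁻¹))`. -/
def z (K : Type*) [Field K] : K⸨X⸩ := HahnSeries.single (-1 : ℤ) (1 : K)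

/-- The embedding `K[z] → K((z⁻¹))`, sending a polynomial to its value at `z`. -/
def ofPoly (K : Type*) [Field K] : K[X] →ₐ[K] K⸨X⸩ := Polynomial.aeval (z K)

/-- `x` lies in the subfield `K(z)` of `K((z⁻¹))`. -/
def IsRational {K : Type*} [Field K] (x : K⸨X⸩) : Prop :=
  ∃ P Q : K[X], Q ≠ 0 ∧ x = ofPoly K P / ofPoly K Q

/-- The derivation `d/dz` of `K((z⁻¹))`. Since `X = z⁻¹`, it is `-X² d/dX`; on coefficients,
`(∑ aₙ z⁻ⁿ)' = ∑ -n aₙ z⁻⁽ⁿ⁺¹⁾`. -/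
def zDeriv {K : Type*} [Field K] (x : K⸨X⸩) : K⸨X⸩ :=
  -(HahnSeries.single (2 : ℤ) (1 : K) * LaurentSeries.derivative K x)

/-- `x` is differential-quadratic: it satisfies a Riccati equation `x' = A x² + B x + C`
with `A, B, C` in `K(z)`. -/
def IsDifferentialQuadratic {K : Type*} [Field K] (x : K⸨X⸩) : Prop :=
  ∃ A B C : K⸨X⸩, IsRational A ∧ IsRational B ∧ IsRational C ∧
    zDeriv x = A * x ^ 2 + B * x + C

/-- `x` (over a field `K` of characteristic `p`) is hyperquadratic: it is irrational and
`x = (A x^(p^s) + B) / (C x^(p^s) + D)` for some integer `s ≥ 1` and some polynomials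
`A, B, C, D` with `A D - B C ≠ 0`. -/
def IsHyperquadratic {K : Type*} [Field K] (p : ℕ) (x : K⸨X⸩) : Prop :=
  ¬ IsRational x ∧ ∃ s : ℕ, 1 ≤ s ∧ ∃ A B C D : K[X], A * D - B * C ≠ 0 ∧
    ofPoly K C * x ^ p ^ s + ofPoly K D ≠ 0 ∧
    x = (ofPoly K A * x ^ p ^ s + ofPoly K B) / (ofPoly K C * x ^ p ^ s + ofPoly K D)

/-- The Thue--Morse sequence with values `false, true`. -/
def thueMorse : ℕ → Bool
  | 0 => false
  | n + 1 => if (n + 1) % 2 = 0 then thueMorse ((n + 1) / 2) else !thueMorse ((n + 1) / 2)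
decreasing_by all_goals omega

/-- The Thue--Morse word `t₀ t₁ t₂ … = a b b a b a a b …` over the alphabet `{a, b}`. -/
def thueMorseWord {α : Type*} (a b : α) (n : ℕ) : α := if thueMorse n then b else a

/-- The formal continued fraction `[0; c₀, c₁, c₂, …]`. -/
def contFract {K : Type*} [Field K] (c : ℕ → K[X]) : GenContFract K⸨X⸩ where
  h := 0
  s := Stream'.Seq.ofStream fun n => ⟨1, ofPoly K (c n)⟩

/-- The `n`-th convergent `pₙ / qₙ = [0; t₀, …, tₙ₋₁]` of the Thue--Morse continued fraction
over `{a, b}`. -/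
def convergent {K : Type*} [Field K] (a b : K[X]) (n : ℕ) : K⸨X⸩ :=
  (contFract (thueMorseWord a b)).convs n

/-- The Thue--Morse continued fraction `ξ = [0; a, b, b, a, b, a, a, b, …]` in `K((z⁻¹))`: the
limit of its convergents. -/
def xi {K : Type*} [Field K] (a b : K[X]) : K⸨X⸩ := limUnder atTop (convergent a b)

end ThueMorseCF

end

/-! In characteristic 2, `ξ` is a Möbius image of a root of a quartic. The elementary continuant
matrices `A`, `B` of the letters are symmetric, so `BA = (AB)ᵀ`, and the squared substitution `A ↦
ABBA`, `B ↦ BAAB` sends the pair to `N Nᵀ`, `Nᵀ N` with `N = AB`. A two-parameter family of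
symmetric matrices is stable under this step (`symMat_mul_mul_transpose`), so the prefixes of length
`4 ^ m` have explicit products (`iterate_substSq_quotMat`). In the limit `ξ = 1 + 1 / w`, where `w =
1 + b / Q + S + S²`, `Q = ab + a + b`, and `S = ∑ σₘ` solves `S⁴ = ρ (S + 1 / Q)` with `ρ = ab / Q`
(`xi_eq`, `quartic_of_tendsto`).

Differentiating the quartic kills its fourth power and gives a linear equation for `S`, hence the
Riccati equation for `ξ` (`riccati_field`).

The partial sums of `S` have denominators of degree `4 ^ m * d`, where `d = deg a + deg b`, and
errors of size `4 ^ (m + 1) * d`. By Liouville's argument `1, S, S², S³` are independent over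
`𝔽₂(z)` (`cubic_eq_zero`), so `ξ` is irrational. The power `w ^ 2 ^ s` reduces to `ρ ^ i S² + ρ ^ j
S + g` with `i ≠ j`; as `ρ` is not a root of unity when `a ≠ b`, a Möbius relation between `w` and
`w ^ 2 ^ s` would give a nontrivial cubic relation for `S`. -/

namespace ThueMorseCF

open WithZero

noncomputable section

/-! ### The degree valuation on `K((z⁻¹))` and convergence. -/

section Valuation
variable {K : Type*} [Field K]

lemma valuation_algebraMap_le (c : K) : Valued.v (algebraMap K K⸨X⸩ c) ≤ (1 : ℤᵐ⁰) := by
  rw [← exp_zero, ← neg_zero, LaurentSeries.valuation_le_iff_coeff_lt_eq_zero]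
  intro n hn
  rw [LaurentSeries.algebraMap_apply, HahnSeries.C_apply, HahnSeries.coeff_single_of_ne hn.ne]

lemma valuation_algebraMap {c : K} (hc : c ≠ 0) :
    Valued.v (algebraMap K K⸨X⸩ c) = (1 : ℤᵐ⁰) := by
  refine le_antisymm (valuation_algebraMap_le c) ?_
  have h := valuation_algebraMap_le c⁻¹
  rw [map_inv₀, map_inv₀] at h
  exact (inv_le_one₀ (by simpa [zero_lt_iff] using hc)).1 h

lemma valuation_z : Valued.v (z K) = (exp 1 : ℤᵐ⁰) := by
  rw [z, LaurentSeries.valuation_single_zpow, neg_neg]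

lemma valuation_ofPoly {P : K[X]} (hP : P ≠ 0) :
    Valued.v (ofPoly K P) = (exp (P.natDegree : ℤ) : ℤᵐ⁰) := by
  have hz (c : K) (i : ℕ) (hc : c ≠ 0) :
      Valued.v (algebraMap K K⸨X⸩ c * z K ^ i) = (exp (i : ℤ) : ℤᵐ⁰) := by
    rw [map_mul, map_pow, valuation_algebraMap hc, valuation_z, one_mul,
      ← exp_nsmul]
    simp
  rw [ofPoly, Polynomial.aeval_def, Polynomial.eval₂_eq_sum_range, Finset.sum_range_succ,
    Valuation.map_add_eq_of_lt_right]
  · exact hz _ _ (by simpa using hP)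
  · rw [hz _ _ (by simpa using hP)]
    refine Valuation.map_sum_lt _ (by simp) fun i hi ↦ ?_
    by_cases hc : P.coeff i = 0
    · simp [hc]
    · rw [hz _ _ hc]
      simpa using hi

lemma one_le_valuation_ofPoly {P : K[X]} (hP : P ≠ 0) :
    (1 : ℤᵐ⁰) ≤ Valued.v (ofPoly K P) := by
  rw [valuation_ofPoly hP, ← exp_zero, exp_le_exp]
  positivity

lemma ofPoly_ne_zero {P : K[X]} (hP : P ≠ 0) : ofPoly K P ≠ 0 := by
  intro h
  have := one_le_valuation_ofPoly hP
  simp [h] at this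

lemma ofPoly_injective : Function.Injective (ofPoly K) :=
  (injective_iff_map_eq_zero _).2 fun _ h ↦ by_contra fun hP ↦ ofPoly_ne_zero hP h

lemma tendsto_zero_of_valuation_le {x : ℕ → K⸨X⸩}
    (h : ∀ n, Valued.v (x n) ≤ (exp (-(n : ℤ)) : ℤᵐ⁰)) : Tendsto x atTop (𝓝 0) := by
  rw [(Valued.hasBasis_nhds_zero K⸨X⸩ ℤᵐ⁰).tendsto_right_iff]
  intro γ _
  have h0 : MonoidWithZeroHom.ValueGroup₀.embedding γ.1 ≠ 0 := by simp
  filter_upwards [eventually_gt_atTop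
    (-log (MonoidWithZeroHom.ValueGroup₀.embedding γ.1)).toNat] with n hn
  refine (Valuation.restrict_lt_iff_lt_embedding _).2 ?_
  refine (h n).trans_lt ?_
  rw [← lt_log_iff_exp_lt h0]
  omega

lemma eventually_valuation_lt_one {ι : Type*} {l : Filter ι} {x : ι → K⸨X⸩}
    (h : Tendsto x l (𝓝 0)) : ∀ᶠ i in l, Valued.v (x i) < (1 : ℤᵐ⁰) := by
  have h1 : {y : K⸨X⸩ | Valued.v y < (1 : ℤᵐ⁰)} ∈ 𝓝 0 :=
    Valued.mem_nhds_zero.2 ⟨1, fun y hy ↦ (Valuation.restrict_lt_one_iff _).1 hy⟩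
  exact h h1

lemma nonarchimedeanAddGroup : NonarchimedeanAddGroup K⸨X⸩ where
  is_nonarchimedean U hU := by
    obtain ⟨γ, hγ⟩ := Valued.mem_nhds_zero.1 hU
    refine ⟨⟨(Valued.v (R := K⸨X⸩) (Γ₀ := ℤᵐ⁰)).restrict.ltAddSubgroup γ, ?_⟩, hγ⟩
    exact AddSubgroup.isOpen_of_mem_nhds _ (Valued.mem_nhds_zero.2 ⟨γ, subset_rfl⟩)

lemma exists_tendsto_of_valuation_sub_le {x : ℕ → K⸨X⸩}
    (h : ∀ n, Valued.v (x (n + 1) - x n) ≤ (exp (-(n : ℤ)) : ℤᵐ⁰)) :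
    ∃ y, Tendsto x atTop (𝓝 y) := by
  have : NonarchimedeanAddGroup K⸨X⸩ := nonarchimedeanAddGroup
  exact cauchySeq_tendsto_of_complete
    (NonarchimedeanAddGroup.cauchySeq_of_tendsto_sub_nhds_zero (tendsto_zero_of_valuation_le h))

end Valuation

/-! ### The derivation `d/dz`. -/

section Derivation
variable {K : Type*} [Field K]

/-- The Euler operator `∑ aₙ Xⁿ ↦ ∑ n aₙ Xⁿ` on Laurent series. -/
def euler (x : K⸨X⸩) : K⸨X⸩ := HahnSeries.single (1 : ℤ) (1 : K) * LaurentSeries.derivative K x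

lemma coeff_euler (x : K⸨X⸩) (n : ℤ) : (euler x).coeff n = n * x.coeff n := by
  simp [euler, HahnSeries.coeff_single_mul]

lemma support_euler (x : K⸨X⸩) : (euler x).support ⊆ x.support := by
  intro n hn h
  exact hn (by rw [coeff_euler, h, mul_zero])

/-- Unlike the derivative, the Euler operator neither shifts nor enlarges supports, so all three
products are summed over the same pairs `i + j = n`, where `n = i + j` is the Leibniz rule. -/
lemma euler_mul (x y : K⸨X⸩) : euler (x * y) = x * euler y + y * euler x := by
  ext n
  rw [mul_comm y, HahnSeries.coeff_add, coeff_euler,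
    HahnSeries.coeff_mul_right' y.isPWO_support (support_euler y),
    HahnSeries.coeff_mul_left' x.isPWO_support (support_euler x), HahnSeries.coeff_mul,
    Finset.mul_sum, ← Finset.sum_add_distrib]
  refine Finset.sum_congr rfl fun ij hij ↦ ?_
  rw [coeff_euler, coeff_euler, ← (Finset.mem_antidiagonal.1 hij).2.2]
  push_cast
  ring

lemma zDeriv_eq_euler (x : K⸨X⸩) : zDeriv x = -(HahnSeries.single (1 : ℤ) (1 : K) * euler x) := by
  rw [zDeriv, euler, ← mul_assoc, HahnSeries.single_mul_single]
  norm_num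

lemma euler_algebraMap (c : K) : euler (algebraMap K K⸨X⸩ c) = 0 := by
  ext n
  rw [coeff_euler, LaurentSeries.algebraMap_apply, HahnSeries.C_apply]
  by_cases h : n = 0
  · simp [h]
  · rw [HahnSeries.coeff_single_of_ne h]
    simp

lemma zDeriv_mul (x y : K⸨X⸩) : zDeriv (x * y) = x * zDeriv y + y * zDeriv x := by
  simp only [zDeriv_eq_euler, euler_mul]
  ring

lemma zDeriv_add (x y : K⸨X⸩) : zDeriv (x + y) = zDeriv x + zDeriv y := by
  simp only [zDeriv, map_add]
  ring

lemma zDeriv_algebraMap (c : K) : zDeriv (algebraMap K K⸨X⸩ c) = 0 := by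
  rw [zDeriv_eq_euler, euler_algebraMap, mul_zero, neg_zero]

lemma zDeriv_z : zDeriv (z K) = 1 := by
  rw [zDeriv_eq_euler]
  ext n
  rw [HahnSeries.coeff_neg, HahnSeries.coeff_single_mul, coeff_euler, z, HahnSeries.coeff_one]
  by_cases h : n = 0
  · simp [h]
  · rw [HahnSeries.coeff_single_of_ne (by omega)]
    simp [h]

lemma exists_zDeriv_ofPoly (P : K[X]) : ∃ P' : K[X], zDeriv (ofPoly K P) = ofPoly K P' := by
  induction P using Polynomial.induction_on' with
  | add P Q hP hQ =>
    obtain ⟨P', hP'⟩ := hP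
    obtain ⟨Q', hQ'⟩ := hQ
    exact ⟨P' + Q', by rw [map_add, zDeriv_add, hP', hQ', map_add]⟩
  | monomial n c =>
    induction n with
    | zero =>
      exact ⟨0, by rw [Polynomial.monomial_zero_left, ofPoly, Polynomial.aeval_C,
        zDeriv_algebraMap, map_zero]⟩
    | succ n ih =>
      obtain ⟨P', hP'⟩ := ih
      refine ⟨Polynomial.monomial n c + Polynomial.X * P', ?_⟩
      have hX : ofPoly K Polynomial.X = z K := by simp [ofPoly]
      rw [← Polynomial.monomial_mul_X, map_mul, zDeriv_mul, hP', hX, zDeriv_z, map_add, map_mul,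
        hX, mul_one]

end Derivation

/-! ### The subfield `K(z)`. -/

section Rational
variable (K : Type*) [Field K]

/-- The subfield `K(z)` of `K((z⁻¹))`. -/
def rationals : Subfield K⸨X⸩ where
  carrier := {x | IsRational x}
  mul_mem' := by
    rintro _ _ ⟨P, Q, hQ, rfl⟩ ⟨P', Q', hQ', rfl⟩
    exact ⟨P * P', Q * Q', mul_ne_zero hQ hQ', by rw [map_mul, map_mul, div_mul_div_comm]⟩
  one_mem' := ⟨1, 1, one_ne_zero, by simp⟩
  add_mem' := by
    rintro _ _ ⟨P, Q, hQ, rfl⟩ ⟨P', Q', hQ', rfl⟩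
    refine ⟨P * Q' + Q * P', Q * Q', mul_ne_zero hQ hQ', ?_⟩
    rw [map_mul, map_add, map_mul, map_mul, div_add_div _ _ (ofPoly_ne_zero hQ) (ofPoly_ne_zero hQ')]
  zero_mem' := ⟨0, 1, one_ne_zero, by simp⟩
  neg_mem' := by
    rintro _ ⟨P, Q, hQ, rfl⟩
    exact ⟨-P, Q, hQ, by rw [map_neg, neg_div]⟩
  inv_mem' := by
    rintro _ ⟨P, Q, hQ, rfl⟩
    by_cases hP : P = 0
    · exact ⟨0, 1, one_ne_zero, by simp [hP]⟩
    · exact ⟨Q, P, hP, by rw [inv_div]⟩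

variable {K}

lemma mem_rationals {x : K⸨X⸩} : x ∈ rationals K ↔ IsRational x := Iff.rfl

lemma ofPoly_mem_rationals (P : K[X]) : ofPoly K P ∈ rationals K :=
  ⟨P, 1, one_ne_zero, by simp⟩

end Rational

/-! ### Prefixes of the Thue–Morse word as products in a monoid. -/

section Words

lemma thueMorse_two_mul (n : ℕ) : thueMorse (2 * n) = thueMorse n := by
  cases n with
  | zero => rfl
  | succ n =>
    rw [show 2 * (n + 1) = 2 * n + 1 + 1 by ring, thueMorse, if_pos (by omega),
      show (2 * n + 1 + 1) / 2 = n + 1 by omega]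

lemma thueMorse_two_mul_add_one (n : ℕ) : thueMorse (2 * n + 1) = !thueMorse n := by
  rw [thueMorse, if_neg (by omega), show (2 * n + 1) / 2 = n by omega]

/-- The product of the first `n` letters of the Thue--Morse word over `{A, B}` in a monoid. -/
def wordProd {M : Type*} [Monoid M] (A B : M) : ℕ → M
  | 0 => 1
  | n + 1 => wordProd A B n * thueMorseWord A B n

variable {M : Type*} [Monoid M]

/-- The word is fixed by `a ↦ ab`, `b ↦ ba`, so doubling the length amounts to substituting the
letters. -/
lemma wordProd_two_mul (A B : M) (n : ℕ) :
    wordProd A B (2 * n) = wordProd (A * B) (B * A) n := by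
  induction n with
  | zero => rfl
  | succ n ih =>
    rw [show 2 * (n + 1) = 2 * n + 1 + 1 by ring, wordProd, wordProd, wordProd, ih, mul_assoc,
      thueMorseWord, thueMorseWord, thueMorseWord, thueMorse_two_mul_add_one, thueMorse_two_mul]
    cases thueMorse n <;> simp

/-- The square of the Thue--Morse substitution, `A ↦ ABBA`, `B ↦ BAAB`, in a monoid. -/
def substSq (x : M × M) : M × M :=
  (x.1 * x.2 * (x.2 * x.1), x.2 * x.1 * (x.1 * x.2))

lemma wordProd_four_pow (m : ℕ) (x : M × M) :
    wordProd x.1 x.2 (4 ^ m) = (substSq^[m] x).1 := by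
  induction m generalizing x with
  | zero => simp [wordProd, thueMorseWord, thueMorse]
  | succ m ih =>
    rw [show 4 ^ (m + 1) = 2 * (2 * 4 ^ m) by ring, wordProd_two_mul, wordProd_two_mul,
      Function.iterate_succ_apply, ← ih, substSq]

end Words

/-! ### A family of symmetric matrices stable under the squared substitution. -/

section Matrices
open Matrix
variable {F : Type*} [Field F]

/-- The elementary continuant matrix of a partial quotient. -/
def quotMat (t : F) : Matrix (Fin 2) (Fin 2) F := !![t, 1; 1, 0]

/-- The matrix `τ v vᵀ + τ⁻¹ e eᵀ` with `v = (n, n + 1)` and `e = (1, 1)`. -/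
def symMat (τ n : F) : Matrix (Fin 2) (Fin 2) F :=
  !![τ * n ^ 2 + τ⁻¹, τ * (n ^ 2 + n) + τ⁻¹; τ * (n ^ 2 + n) + τ⁻¹, τ * (n + 1) ^ 2 + τ⁻¹]

lemma symMat_transpose (τ n : F) : (symMat τ n)ᵀ = symMat τ n := by
  ext i j; fin_cases i <;> fin_cases j <;> rfl

lemma symMat_mul [CharP F 2] {τ ρ : F} (hτ : τ ≠ 0) (n : F) :
    symMat τ n * symMat τ (n + 1 + ρ) =
      !![τ ^ 2 * ρ * n * (n + 1 + ρ) + n + (n + 1 + ρ), τ ^ 2 * ρ * n * (n + ρ) + n + (n + ρ);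
        τ ^ 2 * ρ * (n + 1) * (n + 1 + ρ) + (n + 1) + (n + 1 + ρ),
        τ ^ 2 * ρ * (n + 1) * (n + ρ) + (n + 1) + (n + ρ)] := by
  have h2 : (2 : F) = 0 := CharTwo.two_eq_zero
  have h3 : τ * τ⁻¹ = 1 := mul_inv_cancel₀ hτ
  generalize τ⁻¹ = σ at *
  ext i j
  fin_cases i <;> fin_cases j <;> simp [symMat, mul_apply, Fin.sum_univ_two] <;> grind

/-- With the companion lemma for `Nᵀ N`, this shows that the offset `1 + ρ` between the two second
parameters survives the step, while the first one moves by `s + s²`. -/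
lemma symMat_mul_mul_transpose [CharP F 2] {τ s ρ : F} (hs : s ≠ 0) (hτ : τ ≠ 0)
    (h : s * ρ * τ ^ 2 = 1) (n : F) :
    (symMat τ n * symMat τ (n + 1 + ρ)) * (symMat τ n * symMat τ (n + 1 + ρ))ᵀ =
      symMat (s ^ 2)⁻¹ (n + s + s ^ 2) := by
  have h2 : (2 : F) = 0 := CharTwo.two_eq_zero
  rw [symMat_mul hτ]
  ext i j
  fin_cases i <;> fin_cases j <;> simp [symMat, mul_apply, Fin.sum_univ_two] <;> grind

lemma symMat_mul_transpose_mul [CharP F 2] {τ s ρ : F} (hs : s ≠ 0) (hτ : τ ≠ 0)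
    (h : s * ρ * τ ^ 2 = 1) (n : F) :
    (symMat τ n * symMat τ (n + 1 + ρ))ᵀ * (symMat τ n * symMat τ (n + 1 + ρ)) =
      symMat (s ^ 2)⁻¹ (n + s + s ^ 2 + 1 + ρ) := by
  have h2 : (2 : F) = 0 := CharTwo.two_eq_zero
  rw [symMat_mul hτ]
  ext i j
  fin_cases i <;> fin_cases j <;> simp [symMat, mul_apply, Fin.sum_univ_two] <;> grind

/-- The terms of the series `S = ∑ σₘ` solving `S⁴ = ρ (S + 1 / Q)`. -/
def sigma (α β : F) : ℕ → F
  | 0 => (α * β + α + β)⁻¹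
  | m + 1 => sigma α β m ^ 4 * (α * β + α + β) / (α * β)

/-- The partial sums of `∑ σₘ`. -/
def sigmaSum (α β : F) (m : ℕ) : F := ∑ j ∈ Finset.range (m + 1), sigma α β j

variable {α β : F}

lemma sigma_ne_zero (hα : α ≠ 0) (hβ : β ≠ 0) (hQ : α * β + α + β ≠ 0) (m : ℕ) :
    sigma α β m ≠ 0 := by
  induction m with
  | zero => exact inv_ne_zero hQ
  | succ m ih => exact div_ne_zero (mul_ne_zero (pow_ne_zero _ ih) hQ) (mul_ne_zero hα hβ)

variable [CharP F 2]

/-- At least one substitution is needed for a common `τ`: the entries of `symMat τ n` sum to `τ`,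
those of the two letter matrices to `α` and `β`. -/
lemma iterate_substSq_quotMat (hα : α ≠ 0) (hβ : β ≠ 0) (hQ : α * β + α + β ≠ 0) (m : ℕ) :
    substSq^[m + 1] (quotMat α, quotMat β) =
      (symMat (sigma α β m ^ 2)⁻¹ (1 + β / (α * β + α + β) + sigmaSum α β m + sigmaSum α β m ^ 2),
       symMat (sigma α β m ^ 2)⁻¹ (1 + β / (α * β + α + β) + sigmaSum α β m + sigmaSum α β m ^ 2
          + 1 + α * β / (α * β + α + β))) := by
  have h2 : (2 : F) = 0 := CharTwo.two_eq_zero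
  induction m with
  | zero =>
    have h3 : (α * β + α + β) * (α * β + α + β)⁻¹ = 1 := mul_inv_cancel₀ hQ
    rw [zero_add, Function.iterate_one, substSq]
    ext i j <;> fin_cases i <;> fin_cases j <;>
      simp [symMat, quotMat, mul_apply, Fin.sum_univ_two, sigma, sigmaSum, div_eq_mul_inv] <;> grind
  | succ m ih =>
    have hσ := sigma_ne_zero hα hβ hQ m
    have hσ' := sigma_ne_zero hα hβ hQ (m + 1)
    -- The condition `s ρ τ² = 1` of the stability lemmas is the recursion defining `sigma`.
    have h : sigma α β (m + 1) * (α * β / (α * β + α + β)) * ((sigma α β m ^ 2)⁻¹) ^ 2 = 1 := by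
      rw [sigma]
      generalize α * β + α + β = Q at hQ ⊢
      field_simp
    have hS : sigmaSum α β (m + 1) = sigmaSum α β m + sigma α β (m + 1) :=
      Finset.sum_range_succ _ _
    have hn : 1 + β / (α * β + α + β) + sigmaSum α β (m + 1) + sigmaSum α β (m + 1) ^ 2 =
      1 + β / (α * β + α + β) + sigmaSum α β m + sigmaSum α β m ^ 2 + sigma α β (m + 1)
        + sigma α β (m + 1) ^ 2 := by
      rw [hS]
      grind
    rw [Function.iterate_succ_apply', ih, substSq, hn]
    have hm := symMat_mul_mul_transpose hσ' (inv_ne_zero (pow_ne_zero 2 hσ)) h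
    have hm' := symMat_mul_transpose_mul hσ' (inv_ne_zero (pow_ne_zero 2 hσ)) h
    simp only [transpose_mul, symMat_transpose] at hm hm'
    rw [hm, hm']

end Matrices

/-! ### Continuants and convergence of the continued fraction. -/

section Convergents
variable {K : Type*} [Field K]

lemma contFract_get (c : ℕ → K[X]) (n : ℕ) :
    (contFract c).s.get? n = some ⟨1, ofPoly K (c n)⟩ := rfl

lemma contsAux_add_two (c : ℕ → K[X]) (n : ℕ) :
    (contFract c).contsAux (n + 2) =
      ⟨ofPoly K (c n) * ((contFract c).contsAux (n + 1)).a + ((contFract c).contsAux n).a,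
       ofPoly K (c n) * ((contFract c).contsAux (n + 1)).b + ((contFract c).contsAux n).b⟩ := by
  rw [GenContFract.contsAux_recurrence (contFract_get c n) rfl rfl, one_mul, one_mul]

lemma wordProd_quotMat (a b : K[X]) (n : ℕ) :
    wordProd (quotMat (ofPoly K a)) (quotMat (ofPoly K b)) n =
      !![((contFract (thueMorseWord a b)).contsAux (n + 1)).b,
          ((contFract (thueMorseWord a b)).contsAux n).b;
        ((contFract (thueMorseWord a b)).contsAux (n + 1)).a,
          ((contFract (thueMorseWord a b)).contsAux n).a] := by
  induction n with
  | zero =>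
    ext i j
    fin_cases i <;> fin_cases j <;> simp [wordProd, GenContFract.contsAux, contFract]
  | succ n ih =>
    have hw : thueMorseWord (quotMat (ofPoly K a)) (quotMat (ofPoly K b)) n =
        quotMat (ofPoly K (thueMorseWord a b n)) := by
      unfold thueMorseWord
      split_ifs <;> rfl
    rw [wordProd, ih, hw, contsAux_add_two, quotMat]
    ext i j
    fin_cases i <;> fin_cases j <;> simp [Matrix.mul_apply, Fin.sum_univ_two, mul_comm]

lemma convergent_eq_wordProd (a b : K[X]) (n : ℕ) :
    convergent a b n = wordProd (quotMat (ofPoly K a)) (quotMat (ofPoly K b)) n 1 0 /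
      wordProd (quotMat (ofPoly K a)) (quotMat (ofPoly K b)) n 0 0 := by
  rw [wordProd_quotMat]
  rfl

/-- The strict growth lets the leading term dominate the recurrence; the exponential bound makes the
convergents Cauchy. -/
lemma valuation_contsAux_succ {c : ℕ → K[X]} (hc : ∀ n, 1 ≤ (c n).natDegree) (n : ℕ) :
    (exp (n : ℤ) : ℤᵐ⁰) ≤ Valued.v ((contFract c).contsAux (n + 1)).b ∧
      Valued.v ((contFract c).contsAux n).b < Valued.v ((contFract c).contsAux (n + 1)).b := by
  induction n with
  | zero => simp [GenContFract.contsAux]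
  | succ n ih =>
    obtain ⟨h1, h2⟩ := ih
    have hv : (exp 1 : ℤᵐ⁰) ≤ Valued.v (ofPoly K (c n)) := by
      rw [valuation_ofPoly (Polynomial.ne_zero_of_natDegree_gt (hc n)), exp_le_exp]
      exact_mod_cast hc n
    have h0 : (0 : ℤᵐ⁰) < Valued.v ((contFract c).contsAux (n + 1)).b := h2.trans_le' zero_le
    have h3 : Valued.v ((contFract c).contsAux (n + 1)).b <
        Valued.v (ofPoly K (c n) * ((contFract c).contsAux (n + 1)).b) := by
      rw [map_mul]
      refine lt_mul_left h0 (lt_of_lt_of_le ?_ hv)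
      rw [← exp_zero, exp_lt_exp]
      exact one_pos
    have h4 : Valued.v ((contFract c).contsAux (n + 2)).b =
        Valued.v (ofPoly K (c n)) * Valued.v ((contFract c).contsAux (n + 1)).b := by
      rw [contsAux_add_two, Valuation.map_add_eq_of_lt_left _ (h2.trans h3), map_mul]
    refine ⟨?_, ?_⟩
    · rw [h4, Nat.cast_succ, add_comm, exp_add]
      exact mul_le_mul' hv h1
    · rwa [h4, ← map_mul]

lemma contsAux_det (c : ℕ → K[X]) (n : ℕ) :
    ((contFract c).contsAux (n + 1)).b * ((contFract c).contsAux n).a -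
      ((contFract c).contsAux n).b * ((contFract c).contsAux (n + 1)).a = (-1) ^ n := by
  induction n with
  | zero => simp [GenContFract.contsAux, contFract]
  | succ n ih =>
    rw [contsAux_add_two, pow_succ, ← ih]
    ring

lemma exists_tendsto_convs {c : ℕ → K[X]} (hc : ∀ n, 1 ≤ (c n).natDegree) :
    ∃ y, Tendsto (contFract c).convs atTop (𝓝 y) := by
  refine exists_tendsto_of_valuation_sub_le fun n ↦ ?_
  obtain ⟨h1, -⟩ := valuation_contsAux_succ hc n
  obtain ⟨h2, -⟩ := valuation_contsAux_succ hc (n + 1)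
  have hpos (k : ℤ) : (0 : ℤᵐ⁰) < exp k := exp_pos
  have hq : ((contFract c).contsAux (n + 1)).b ≠ 0 :=
    (Valuation.ne_zero_iff _).1 ((hpos _).trans_le h1).ne'
  have hq' : ((contFract c).contsAux (n + 1 + 1)).b ≠ 0 :=
    (Valuation.ne_zero_iff _).1 ((hpos _).trans_le h2).ne'
  have hd : (contFract c).convs (n + 1) - (contFract c).convs n =
      -(-1) ^ (n + 1) /
        (((contFract c).contsAux (n + 1 + 1)).b * ((contFract c).contsAux (n + 1)).b) := by
    rw [← contsAux_det]
    change ((contFract c).contsAux (n + 1 + 1)).a / ((contFract c).contsAux (n + 1 + 1)).b -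
      ((contFract c).contsAux (n + 1)).a / ((contFract c).contsAux (n + 1)).b = _
    field_simp
    ring
  rw [hd, map_div₀, Valuation.map_neg, map_pow, Valuation.map_neg, map_one, one_pow, map_mul,
    one_div, exp_neg]
  refine inv_anti₀ (hpos _) (h1.trans (le_mul_of_one_le_left' (h2.trans' ?_)))
  rw [← exp_zero, exp_le_exp]
  positivity

lemma natDegree_thueMorseWord {a b : K[X]} (ha : 1 ≤ a.natDegree) (hb : 1 ≤ b.natDegree) (n : ℕ) :
    1 ≤ (thueMorseWord a b n).natDegree := by
  unfold thueMorseWord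
  split_ifs <;> assumption

lemma tendsto_convergent {a b : K[X]} (ha : 1 ≤ a.natDegree) (hb : 1 ≤ b.natDegree) :
    Tendsto (convergent a b) atTop (𝓝 (xi a b)) :=
  tendsto_nhds_limUnder (exists_tendsto_convs (natDegree_thueMorseWord ha hb))

end Convergents

instance : CharP (ZMod 2)⸨X⸩ 2 :=
  charP_of_injective_algebraMap (algebraMap (ZMod 2) (ZMod 2)⸨X⸩).injective 2

/-! ### Degrees of the terms of `S`. -/

section Degrees
variable {K : Type*} [Field K] {a b : K[X]}

lemma natDegree_mul_add_add (ha : 1 ≤ a.natDegree) (hb : 1 ≤ b.natDegree) :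
    (a * b + a + b).natDegree = a.natDegree + b.natDegree := by
  have hab : (a * b).natDegree = a.natDegree + b.natDegree :=
    Polynomial.natDegree_mul (Polynomial.ne_zero_of_natDegree_gt ha)
      (Polynomial.ne_zero_of_natDegree_gt hb)
  rw [add_assoc, Polynomial.natDegree_add_eq_left_of_natDegree_lt, hab]
  exact (Polynomial.natDegree_add_le a b).trans_lt (by rw [hab]; simp; omega)

lemma mul_add_add_ne_zero (ha : 1 ≤ a.natDegree) (hb : 1 ≤ b.natDegree) : a * b + a + b ≠ 0 :=
  Polynomial.ne_zero_of_natDegree_gt (n := 0) (by rw [natDegree_mul_add_add ha hb]; omega)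

lemma valuation_sigma (ha : 1 ≤ a.natDegree) (hb : 1 ≤ b.natDegree) (m : ℕ) :
    Valued.v (sigma (ofPoly K a) (ofPoly K b) m) =
      (exp (-(4 ^ m * (a.natDegree + b.natDegree) : ℤ)) : ℤᵐ⁰) := by
  have hQ : Valued.v (ofPoly K a * ofPoly K b + ofPoly K a + ofPoly K b) =
      (exp (a.natDegree + b.natDegree : ℤ) : ℤᵐ⁰) := by
    rw [← map_mul, ← map_add, ← map_add, valuation_ofPoly (mul_add_add_ne_zero ha hb),
      natDegree_mul_add_add ha hb, Nat.cast_add]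
  induction m with
  | zero => rw [sigma, map_inv₀, hQ, pow_zero, one_mul, exp_neg]
  | succ m ih =>
    rw [sigma, map_div₀, map_mul, map_mul, map_pow, ih, hQ,
      valuation_ofPoly (Polynomial.ne_zero_of_natDegree_gt ha),
      valuation_ofPoly (Polynomial.ne_zero_of_natDegree_gt hb), ← exp_add,
      mul_div_cancel_right₀ _ exp_ne_zero, ← exp_nsmul]
    congr 1
    simp only [nsmul_eq_mul]
    push_cast
    ring

lemma valuation_sigma_lt_one (ha : 1 ≤ a.natDegree) (hb : 1 ≤ b.natDegree) (m : ℕ) :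
    Valued.v (sigma (ofPoly K a) (ofPoly K b) m) < (1 : ℤᵐ⁰) := by
  rw [valuation_sigma ha hb, ← exp_zero, exp_lt_exp, neg_lt_zero]
  have : 0 < (4 : ℤ) ^ m := by positivity
  have : (0 : ℤ) < a.natDegree + b.natDegree := by omega
  positivity

lemma valuation_sigma_le (ha : 1 ≤ a.natDegree) (hb : 1 ≤ b.natDegree) (m : ℕ) :
    Valued.v (sigma (ofPoly K a) (ofPoly K b) m) ≤ (exp (-(m : ℤ)) : ℤᵐ⁰) := by
  rw [valuation_sigma ha hb, exp_le_exp, neg_le_neg_iff]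
  have h1 : (m : ℤ) ≤ 4 ^ m := by exact_mod_cast (Nat.lt_pow_self (by norm_num)).le
  have h2 : (1 : ℤ) ≤ a.natDegree + b.natDegree := by omega
  nlinarith

lemma valuation_sigmaSum_lt_one (ha : 1 ≤ a.natDegree) (hb : 1 ≤ b.natDegree) (m : ℕ) :
    Valued.v (sigmaSum (ofPoly K a) (ofPoly K b) m) < (1 : ℤᵐ⁰) :=
  Valuation.map_sum_lt _ one_ne_zero fun j _ ↦ valuation_sigma_lt_one ha hb j

lemma exists_tendsto_sigmaSum (ha : 1 ≤ a.natDegree) (hb : 1 ≤ b.natDegree) :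
    ∃ S, Tendsto (sigmaSum (ofPoly K a) (ofPoly K b)) atTop (𝓝 S) := by
  refine exists_tendsto_of_valuation_sub_le fun n ↦ ?_
  rw [sigmaSum, Finset.sum_range_succ, ← sigmaSum, add_sub_cancel_left]
  exact (valuation_sigma_le ha hb (n + 1)).trans (exp_le_exp.2 (by push_cast; omega))

end Degrees

/-! ### The quartic equation and rational approximation of its root. -/

section Approximation

lemma sigmaSum_succ {F : Type*} [Field F] [CharP F 2] (α β : F) (m : ℕ) :
    sigmaSum α β (m + 1) = (α * β + α + β)⁻¹ +
      sigmaSum α β m ^ 4 * (α * β + α + β) / (α * β) := by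
  rw [sigmaSum, Finset.sum_range_succ', add_comm, sigmaSum,
    show (4 : ℕ) = 2 ^ 2 by norm_num, sum_pow_char_pow, Finset.sum_mul, Finset.sum_div]
  rfl

variable {a b : (ZMod 2)[X]} {S : (ZMod 2)⸨X⸩}

/-- The limit of the partial sums is a root of the quartic. -/
lemma quartic_of_tendsto
    (hS : Tendsto (sigmaSum (ofPoly _ a) (ofPoly _ b)) atTop (𝓝 S)) :
    S = (ofPoly _ (a * b + a + b))⁻¹ + S ^ 4 * ofPoly _ (a * b + a + b) / ofPoly _ (a * b) := by
  have h1 := hS.comp (tendsto_add_atTop_nat 1)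
  refine tendsto_nhds_unique h1 ?_
  simp only [Function.comp_def, sigmaSum_succ, map_add, map_mul, div_eq_mul_inv]
  exact tendsto_const_nhds.add (((hS.pow 4).mul_const _).mul_const _)

lemma valuation_limit_lt_one (ha : 1 ≤ a.natDegree) (hb : 1 ≤ b.natDegree)
    (hS : Tendsto (sigmaSum (ofPoly _ a) (ofPoly _ b)) atTop (𝓝 S)) :
    Valued.v S < (1 : ℤᵐ⁰) := by
  have h : Tendsto (fun m ↦ sigmaSum (ofPoly _ a) (ofPoly _ b) m - S) atTop (𝓝 0) := by
    simpa using hS.sub_const S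
  obtain ⟨m, hm⟩ := (eventually_valuation_lt_one h).exists
  simpa using Valuation.map_sub_lt _ (valuation_sigmaSum_lt_one ha hb m) hm

/-- Fourth powers are additive in characteristic 2, so subtracting the recursion from the quartic
raises the error to its fourth power, up to the factor `Q / ab` of valuation 1. -/
lemma valuation_limit_sub (ha : 1 ≤ a.natDegree) (hb : 1 ≤ b.natDegree)
    (hS : Tendsto (sigmaSum (ofPoly _ a) (ofPoly _ b)) atTop (𝓝 S)) (m : ℕ) :
    Valued.v (S - sigmaSum (ofPoly _ a) (ofPoly _ b) m) =
      (exp (-(4 ^ (m + 1) * (a.natDegree + b.natDegree) : ℤ)) : ℤᵐ⁰) := by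
  have hquart := quartic_of_tendsto hS
  have hlt := valuation_limit_lt_one ha hb hS
  have hQ := mul_add_add_ne_zero ha hb
  have hab : a * b ≠ 0 := mul_ne_zero (Polynomial.ne_zero_of_natDegree_gt ha)
      (Polynomial.ne_zero_of_natDegree_gt hb)
  have hd : (a * b).natDegree = (a * b + a + b).natDegree := by
    rw [natDegree_mul_add_add ha hb, Polynomial.natDegree_mul (Polynomial.ne_zero_of_natDegree_gt ha)
      (Polynomial.ne_zero_of_natDegree_gt hb)]
  have hratio (x : (ZMod 2)⸨X⸩) :
      Valued.v (x ^ 4 * ofPoly _ (a * b + a + b) / ofPoly _ (a * b)) = (Valued.v x ^ 4 : ℤᵐ⁰) := by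
    rw [map_div₀, map_mul, map_pow, valuation_ofPoly hQ, valuation_ofPoly hab, hd,
      mul_div_cancel_right₀ _ exp_ne_zero]
  induction m with
  | zero =>
    have hs : sigmaSum (ofPoly _ a) (ofPoly _ b) 0 = (ofPoly _ (a * b + a + b))⁻¹ := by
      simp [sigmaSum, sigma]
    have h1 : Valued.v (S - sigmaSum (ofPoly _ a) (ofPoly _ b) 0) = (Valued.v S ^ 4 : ℤᵐ⁰) := by
      rw [← hratio, hs, ← sub_eq_of_eq_add' hquart]
    have hS0 : S ≠ 0 := by
      rintro rfl
      rw [zero_pow (by norm_num), zero_mul, zero_div, add_zero] at hquart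
      exact inv_ne_zero (ofPoly_ne_zero hQ) hquart.symm
    -- Since `S` has valuation below 1, its fourth power is smaller still, so `S` and the first term
    -- have equal valuation.
    have h2 : Valued.v (S - sigmaSum (ofPoly _ a) (ofPoly _ b) 0) < (Valued.v S : ℤᵐ⁰) := by
      rw [h1]
      exact pow_lt_self_of_lt_one₀ (zero_lt_iff.2 ((Valuation.ne_zero_iff _).2 hS0)) hlt
        (by norm_num)
    have h3 : Valued.v S = (exp (-(a.natDegree + b.natDegree : ℤ)) : ℤᵐ⁰) := by
      rw [Valuation.map_sub_swap] at h2
      rw [← Valuation.map_eq_of_sub_lt _ h2, hs, map_inv₀, valuation_ofPoly hQ,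
        natDegree_mul_add_add ha hb, exp_neg, Nat.cast_add]
    rw [h1, h3]
    rw [← exp_nsmul]
    congr 1
    simp only [nsmul_eq_mul]
    push_cast
    ring
  | succ m ih =>
    have h : S - sigmaSum (ofPoly _ a) (ofPoly _ b) (m + 1) =
        (S - sigmaSum (ofPoly _ a) (ofPoly _ b) m) ^ 4 * ofPoly _ (a * b + a + b) /
          ofPoly _ (a * b) := by
      rw [sigmaSum_succ, show (4 : ℕ) = 2 ^ 2 by norm_num, sub_pow_char_pow]
      conv_lhs => rw [hquart]
      simp only [map_add, map_mul]
      ring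
    rw [h, hratio, ih, ← exp_nsmul]
    congr 1
    simp only [nsmul_eq_mul]
    push_cast
    ring

/-- The cofactor `Uₘ` in the denominator `(ab + a + b) Uₘ` of the partial sums. -/
def approxCofactor {K : Type*} [Field K] (a b : K[X]) : ℕ → K[X]
  | 0 => 1
  | m + 1 => a * b * (a * b + a + b) ^ 2 * approxCofactor a b m ^ 4

/-- The numerator of the partial sums over the denominator `(ab + a + b) Uₘ`. -/
def approxNum {K : Type*} [Field K] (a b : K[X]) : ℕ → K[X]
  | 0 => 1
  | m + 1 => approxNum a b m * (a * b * (a * b + a + b) ^ 2 * approxCofactor a b m ^ 3) + 1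

section
variable {K : Type*} [Field K] {a b : K[X]}

lemma approxCofactor_ne_zero (ha : 1 ≤ a.natDegree) (hb : 1 ≤ b.natDegree) (m : ℕ) :
    approxCofactor a b m ≠ 0 := by
  induction m with
  | zero => exact one_ne_zero
  | succ m ih =>
    exact mul_ne_zero (mul_ne_zero (mul_ne_zero (Polynomial.ne_zero_of_natDegree_gt ha)
      (Polynomial.ne_zero_of_natDegree_gt hb)) (pow_ne_zero _ (mul_add_add_ne_zero ha hb)))
      (pow_ne_zero _ ih)

lemma sigma_eq_inv (ha : 1 ≤ a.natDegree) (hb : 1 ≤ b.natDegree) (m : ℕ) :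
    sigma (ofPoly K a) (ofPoly K b) m =
      (ofPoly K ((a * b + a + b) * approxCofactor a b m))⁻¹ := by
  induction m with
  | zero => simp [sigma, approxCofactor]
  | succ m ih =>
    have hQ := ofPoly_ne_zero (mul_add_add_ne_zero ha hb)
    have hU := ofPoly_ne_zero (approxCofactor_ne_zero ha hb m)
    have ha' := ofPoly_ne_zero (Polynomial.ne_zero_of_natDegree_gt ha)
    have hb' := ofPoly_ne_zero (Polynomial.ne_zero_of_natDegree_gt hb)
    rw [sigma, ih, approxCofactor, ← map_mul, ← map_add, ← map_add]
    simp only [map_mul, map_pow] at *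
    generalize ofPoly K (a * b + a + b) = Q at *
    field_simp

lemma sigmaSum_eq_div (ha : 1 ≤ a.natDegree) (hb : 1 ≤ b.natDegree) (m : ℕ) :
    sigmaSum (ofPoly K a) (ofPoly K b) m =
      ofPoly K (approxNum a b m) / ofPoly K ((a * b + a + b) * approxCofactor a b m) := by
  induction m with
  | zero => simp [sigmaSum, sigma, approxCofactor, approxNum]
  | succ m ih =>
    have hQ := ofPoly_ne_zero (mul_add_add_ne_zero ha hb)
    have hU := ofPoly_ne_zero (approxCofactor_ne_zero ha hb m)
    have ha' := ofPoly_ne_zero (Polynomial.ne_zero_of_natDegree_gt ha)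
    have hb' := ofPoly_ne_zero (Polynomial.ne_zero_of_natDegree_gt hb)
    rw [sigmaSum, Finset.sum_range_succ, ← sigmaSum, ih, sigma_eq_inv ha hb, approxCofactor,
      approxNum, map_add (ofPoly K) (approxNum a b m * _) 1, map_one]
    simp only [map_mul, map_pow] at *
    generalize ofPoly K (a * b + a + b) = Q at *
    field_simp

lemma valuation_approxDen (ha : 1 ≤ a.natDegree) (hb : 1 ≤ b.natDegree) (m : ℕ) :
    Valued.v (ofPoly K ((a * b + a + b) * approxCofactor a b m)) =
      (exp (4 ^ m * (a.natDegree + b.natDegree) : ℤ) : ℤᵐ⁰) := by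
  have h := valuation_sigma ha hb m
  rw [sigma_eq_inv ha hb, map_inv₀, exp_neg, inv_inj] at h
  exact h

end

/-- Liouville's argument: the partial sums approximate `S` too well for `S` to have degree less
than `4` over `𝔽₂(z)`. -/
lemma cubic_ofPoly_eq_zero (ha : 1 ≤ a.natDegree) (hb : 1 ≤ b.natDegree)
    (hS : Tendsto (sigmaSum (ofPoly _ a) (ofPoly _ b)) atTop (𝓝 S)) (f : Fin 4 → (ZMod 2)[X])
    (h : ofPoly _ (f 0) + ofPoly _ (f 1) * S + ofPoly _ (f 2) * S ^ 2 + ofPoly _ (f 3) * S ^ 3 = 0)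
    (i : Fin 4) : f i = 0 := by
  obtain ⟨M, hM⟩ : ∃ M : ℕ, ∀ i, (f i).natDegree ≤ M :=
    ⟨∑ i, (f i).natDegree, fun i ↦
      Finset.single_le_sum (f := fun i ↦ (f i).natDegree) (fun _ _ ↦ zero_le) (Finset.mem_univ i)⟩
  have hvf (i : Fin 4) : Valued.v (ofPoly _ (f i)) ≤ (exp (M : ℤ) : ℤᵐ⁰) := by
    by_cases h0 : f i = 0
    · simp [h0]
    · rw [valuation_ofPoly h0, exp_le_exp]
      exact_mod_cast hM i
  set s := sigmaSum (ofPoly (ZMod 2) a) (ofPoly (ZMod 2) b) with hs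
  have hvS : Valued.v S ≤ (1 : ℤᵐ⁰) := (valuation_limit_lt_one ha hb hS).le
  have hvs (m : ℕ) : Valued.v (s m) ≤ (1 : ℤᵐ⁰) := (valuation_sigmaSum_lt_one ha hb m).le
  have hroot (m : ℕ) (hm : M ≤ m) : ofPoly _ (f 0) + ofPoly _ (f 1) * s m +
      ofPoly _ (f 2) * s m ^ 2 + ofPoly _ (f 3) * s m ^ 3 = 0 := by
    set R := (a * b + a + b) * approxCofactor a b m with hR
    have hR0 : ofPoly _ R ≠ 0 := ofPoly_ne_zero
      (mul_ne_zero (mul_add_add_ne_zero ha hb) (approxCofactor_ne_zero ha hb m))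
    have hdiv : s m = ofPoly _ (approxNum a b m) / ofPoly _ R := sigmaSum_eq_div ha hb m
    have hG : ofPoly _ (f 0) + ofPoly _ (f 1) * s m + ofPoly _ (f 2) * s m ^ 2 +
        ofPoly _ (f 3) * s m ^ 3 = ofPoly _ (f 0 * R ^ 3 + f 1 * approxNum a b m * R ^ 2 +
          f 2 * approxNum a b m ^ 2 * R + f 3 * approxNum a b m ^ 3) / ofPoly _ R ^ 3 := by
      rw [hdiv]
      simp only [map_add, map_mul, map_pow]
      field_simp
    have hδ : ofPoly _ (f 0) + ofPoly _ (f 1) * s m + ofPoly _ (f 2) * s m ^ 2 +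
        ofPoly _ (f 3) * s m ^ 3 = -((S - s m) * (ofPoly _ (f 1) + ofPoly _ (f 2) * (S + s m) +
          ofPoly _ (f 3) * (S ^ 2 + S * s m + s m ^ 2))) := by
      linear_combination h
    have hbound : Valued.v (ofPoly _ (f 1) + ofPoly _ (f 2) * (S + s m) +
          ofPoly _ (f 3) * (S ^ 2 + S * s m + s m ^ 2)) ≤ (exp (M : ℤ) : ℤᵐ⁰) := by
      have h1 : Valued.v (S + s m) ≤ (1 : ℤᵐ⁰) := Valuation.map_add_le _ hvS (hvs m)
      have h2 : Valued.v (S ^ 2 + S * s m + s m ^ 2) ≤ (1 : ℤᵐ⁰) := by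
        refine Valuation.map_add_le _ (Valuation.map_add_le _ ?_ ?_) ?_
        · rw [map_pow]; exact pow_le_one' hvS 2
        · rw [map_mul]; exact mul_le_one' hvS (hvs m)
        · rw [map_pow]; exact pow_le_one' (hvs m) 2
      refine Valuation.map_add_le _ (Valuation.map_add_le _ (hvf 1) ?_) ?_
      · rw [map_mul]; exact (mul_le_of_le_one_right' h1).trans (hvf 2)
      · rw [map_mul]; exact (mul_le_of_le_one_right' h2).trans (hvf 3)
    by_contra hne
    have hG0 : f 0 * R ^ 3 + f 1 * approxNum a b m * R ^ 2 +
          f 2 * approxNum a b m ^ 2 * R + f 3 * approxNum a b m ^ 3 ≠ 0 := by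
      intro h0
      exact hne (by rw [hG, h0, map_zero, zero_div])
    -- A nonzero value at `s m` has degree at least `-3 * 4 ^ m * d`, with `d = deg a + deg b`, but
    -- the error estimate bounds it by `M - 4 * 4 ^ m * d`; this is impossible as `M ≤ m < 4 ^ m`.
    have hlow := one_le_valuation_ofPoly hG0
    rw [← (eq_div_iff (pow_ne_zero 3 hR0)).1 hG, hδ, map_mul, Valuation.map_neg, map_mul,
      valuation_limit_sub ha hb hS, map_pow, hR, valuation_approxDen ha hb, ← exp_nsmul] at hlow
    have hup := hlow.trans (mul_le_mul_left (mul_le_mul_right hbound _) _)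
    rw [← exp_add, ← exp_add, ← exp_zero, exp_le_exp] at hup
    simp only [nsmul_eq_mul, pow_succ] at hup
    push_cast at hup
    have h4 : (m : ℤ) < 4 ^ m := by exact_mod_cast Nat.lt_pow_self (by norm_num)
    have h2 : (1 : ℤ) ≤ a.natDegree + b.natDegree := by omega
    have hm' : (M : ℤ) ≤ m := by exact_mod_cast hm
    nlinarith
  let p : (ZMod 2)⸨X⸩[X] := Polynomial.C (ofPoly _ (f 0)) + Polynomial.C (ofPoly _ (f 1)) *
    Polynomial.X + Polynomial.C (ofPoly _ (f 2)) * Polynomial.X ^ 2 +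
    Polynomial.C (ofPoly _ (f 3)) * Polynomial.X ^ 3
  -- The errors have distinct valuations, so the cubic has infinitely many roots.
  have hinj : Function.Injective s := by
    intro m m' hmm
    have h1 := valuation_limit_sub ha hb hS m
    rw [← hs, hmm, hs, valuation_limit_sub ha hb hS m', exp_inj, neg_inj] at h1
    have h2 : (a.natDegree + b.natDegree : ℤ) ≠ 0 := by omega
    have h3 := mul_right_cancel₀ h2 h1
    have h4 := Nat.pow_right_injective (by norm_num : 2 ≤ 4) (by exact_mod_cast h3 : 4 ^ (m' + 1) = 4 ^ (m + 1))
    omega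
  have hp : p = 0 := by
    refine Polynomial.eq_zero_of_infinite_isRoot p (Set.Infinite.mono ?_
      ((Set.Ici_infinite M).image hinj.injOn))
    rintro _ ⟨m, hm, rfl⟩
    simpa [p] using hroot m hm
  refine ofPoly_injective ?_
  have hc := congrArg (fun q ↦ q.coeff (i : ℕ)) hp
  fin_cases i <;> simpa [p, Polynomial.coeff_X, Polynomial.coeff_C, Polynomial.coeff_X_pow] using hc

/-- `1, S, S², S³` are linearly independent over `𝔽₂(z)`. -/
lemma cubic_eq_zero (ha : 1 ≤ a.natDegree) (hb : 1 ≤ b.natDegree)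
    (hS : Tendsto (sigmaSum (ofPoly _ a) (ofPoly _ b)) atTop (𝓝 S)) (r : Fin 4 → (ZMod 2)⸨X⸩)
    (hr : ∀ i, r i ∈ rationals (ZMod 2))
    (h : r 0 + r 1 * S + r 2 * S ^ 2 + r 3 * S ^ 3 = 0) (i : Fin 4) : r i = 0 := by
  choose P Q hQ hPQ using fun i ↦ mem_rationals.1 (hr i)
  have hf := cubic_ofPoly_eq_zero ha hb hS (fun i ↦ P i * ∏ j ∈ Finset.univ.erase i, Q j) ?_ i
  · have hprod : ∏ j ∈ Finset.univ.erase i, Q j ≠ 0 := Finset.prod_ne_zero_iff.2 fun j _ ↦ hQ j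
    rw [hPQ, (mul_eq_zero_iff_right hprod).1 hf, map_zero, zero_div]
  · have key (i : Fin 4) : ofPoly _ (P i * ∏ j ∈ Finset.univ.erase i, Q j) =
        (∏ j, ofPoly _ (Q j)) * r i := by
      rw [hPQ, ← Finset.mul_prod_erase _ _ (Finset.mem_univ i), map_mul, map_prod]
      field_simp [ofPoly_ne_zero (hQ i)]
    simp only [key]
    linear_combination (∏ j, ofPoly _ (Q j)) * h

end Approximation

/-! ### The value of `ξ` and its Riccati equation. -/

variable {a b : (ZMod 2)[X]} {S : (ZMod 2)⸨X⸩}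

/-- The element `w = 1 / (1 + ξ)`, in terms of the root `S` of the quartic. -/
def auxW (a b : (ZMod 2)[X]) (S : (ZMod 2)⸨X⸩) : (ZMod 2)⸨X⸩ :=
  1 + ofPoly _ b / ofPoly _ (a * b + a + b) + S + S ^ 2

lemma auxW_ne_zero (ha : 1 ≤ a.natDegree) (hb : 1 ≤ b.natDegree)
    (hS : Tendsto (sigmaSum (ofPoly _ a) (ofPoly _ b)) atTop (𝓝 S)) : auxW a b S ≠ 0 := by
  have hlt := valuation_limit_lt_one ha hb hS
  have h1 : Valued.v (ofPoly _ b / ofPoly _ (a * b + a + b)) < (1 : ℤᵐ⁰) := by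
    rw [map_div₀, valuation_ofPoly (mul_add_add_ne_zero ha hb), natDegree_mul_add_add ha hb,
      valuation_ofPoly (Polynomial.ne_zero_of_natDegree_gt hb), div_lt_one₀ exp_pos, exp_lt_exp]
    omega
  have h2 : Valued.v (S ^ 2) < (1 : ℤᵐ⁰) := by
    rw [map_pow]
    exact pow_lt_one₀ zero_le hlt two_ne_zero
  have h3 : Valued.v (auxW a b S) = (1 : ℤᵐ⁰) := by
    rw [auxW, add_assoc, add_assoc, Valuation.map_add_eq_of_lt_left, map_one]
    rw [map_one]
    exact Valuation.map_add_lt _ h1 (Valuation.map_add_lt _ hlt h2)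
  intro h0
  simp [h0] at h3

lemma xi_eq (ha : 1 ≤ a.natDegree) (hb : 1 ≤ b.natDegree)
    (hS : Tendsto (sigmaSum (ofPoly _ a) (ofPoly _ b)) atTop (𝓝 S)) :
    xi a b = 1 + (auxW a b S)⁻¹ := by
  have hw := auxW_ne_zero ha hb hS
  have ha' := ofPoly_ne_zero (Polynomial.ne_zero_of_natDegree_gt ha)
  have hb' := ofPoly_ne_zero (Polynomial.ne_zero_of_natDegree_gt hb)
  have hQ := ofPoly_ne_zero (mul_add_add_ne_zero ha hb)
  rw [map_add, map_add, map_mul] at hQ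
  have hsub : Tendsto (fun m ↦ 4 ^ (m + 1)) atTop atTop :=
    (tendsto_pow_atTop_atTop_of_one_lt (by norm_num)).comp (tendsto_add_atTop_nat 1)
  have h1 := (tendsto_convergent ha hb).comp hsub
  refine tendsto_nhds_unique h1 ?_
  set σ := sigma (ofPoly (ZMod 2) a) (ofPoly (ZMod 2) b)
  have hconv (m : ℕ) : convergent a b (4 ^ (m + 1)) =
      (auxW a b (sigmaSum (ofPoly _ a) (ofPoly _ b) m) ^ 2 +
        auxW a b (sigmaSum (ofPoly _ a) (ofPoly _ b) m) + σ m ^ 4) /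
      (auxW a b (sigmaSum (ofPoly _ a) (ofPoly _ b) m) ^ 2 + σ m ^ 4) := by
    have hσ : σ m ≠ 0 := sigma_ne_zero ha' hb' hQ m
    have hP := wordProd_four_pow (m + 1)
      (quotMat (ofPoly (ZMod 2) a), quotMat (ofPoly (ZMod 2) b))
    rw [iterate_substSq_quotMat ha' hb' hQ] at hP
    change _ = symMat (σ m ^ 2)⁻¹ _ at hP
    have hW : 1 + ofPoly _ b / (ofPoly _ a * ofPoly _ b + ofPoly _ a + ofPoly _ b) +
        sigmaSum (ofPoly _ a) (ofPoly _ b) m + sigmaSum (ofPoly _ a) (ofPoly _ b) m ^ 2 =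
        auxW a b (sigmaSum (ofPoly _ a) (ofPoly _ b) m) := by
      rw [auxW, map_add, map_add, map_mul]
    rw [convergent_eq_wordProd, hP, hW, symMat]
    simp only [Matrix.of_apply, Matrix.cons_val', Matrix.cons_val_zero, Matrix.cons_val_one,
      inv_inv]
    -- Scaling by `σ²` clears `τ = σ⁻²` and turns `τ⁻¹` into `σ⁴`, which tends to 0.
    rw [← mul_div_mul_left _ _ (pow_ne_zero 2 hσ)]
    congr 1 <;> field_simp
  simp only [Function.comp_def, hconv]
  have hσ : Tendsto σ atTop (𝓝 0) := tendsto_zero_of_valuation_le (valuation_sigma_le ha hb)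
  have hW : Tendsto (fun m ↦ auxW a b (sigmaSum (ofPoly _ a) (ofPoly _ b) m)) atTop
      (𝓝 (auxW a b S)) := (hS.const_add _).add (hS.pow 2)
  have hlim := (((hW.pow 2).add hW).add (hσ.pow 4)).div ((hW.pow 2).add (hσ.pow 4))
    (by simpa using hw)
  convert! hlim using 2
  simp only [ne_eq, OfNat.ofNat_ne_zero, not_false_eq_true, zero_pow, add_zero]
  field_simp

/-- Squares have derivative zero, so the quartic gives `D S`, and hence `D w`, as an affine function
of `S`. The quartic also makes `w² + w` affine in `S`; a combination of the two eliminates `S`. -/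
lemma riccati_field {F : Type*} [Field F] [CharP F 2] (D : F → F)
    (hadd : ∀ x y, D (x + y) = D x + D y) (hmul : ∀ x y, D (x * y) = x * D y + y * D x)
    {α β S w x : F} (hQ : α * β + α + β ≠ 0) (hw : w ≠ 0)
    (hS : S ^ 4 * (α * β + α + β) ^ 2 = α * β * ((α * β + α + β) * S + 1))
    (hwS : w * (α * β + α + β) = (α * β + α + β) + β + (α * β + α + β) * S + (α * β + α + β) * S ^ 2)
    (hx : x * w = w + 1) :
    D (α * β * (α + β) * x) = D (α * β) * (1 + x ^ 2) := by
  have h2 : (2 : F) = 0 := CharTwo.two_eq_zero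
  have hsq (y : F) : D (y ^ 2) = 0 := by
    rw [pow_two, hmul]
    linear_combination y * D y * h2
  have h1 : D 1 = 0 := by simpa using hsq 1
  have hp : D (α * β) = α * D β + β * D α := hmul _ _
  have hDQ : D (α * β + α + β) = D (α * β) + D α + D β := by rw [hadd, hadd]
  have hG : D (α * β * (α + β)) = α * β * (D α + D β) + (α + β) * D (α * β) := by
    rw [hmul, hadd]
  obtain ⟨Q, hQe⟩ : ∃ Q, Q = α * β + α + β := ⟨_, rfl⟩
  rw [← hQe] at hQ hS hwS hDQ
  have eS : α * β * (Q * D S + S * D Q) + (Q * S + 1) * D (α * β) = 0 := by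
    have h := congrArg D hS
    rw [show S ^ 4 * Q ^ 2 = (S ^ 2 * Q) ^ 2 by ring, hsq, hmul, hadd _ 1, h1, hmul Q] at h
    linear_combination -h
  have eW : Q ^ 2 * D w = Q * D β + Q ^ 2 * D S + D Q * β := by
    have h := congrArg D hwS
    simp only [hadd, hmul, hsq] at h
    grind
  have eX : w ^ 2 * D x = D w := by
    have h := congrArg D hx
    rw [hmul, hadd, h1] at h
    grind
  have eX2 : x ^ 2 * w ^ 2 = w ^ 2 + 1 := by grind
  have eWW : Q ^ 2 * (w ^ 2 + w) = Q * β + β ^ 2 + Q ^ 2 * S + α * β * (Q * S + 1) := by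
    have h : (w * Q) ^ 2 = Q ^ 2 + β ^ 2 + Q ^ 2 * S ^ 2 + S ^ 4 * Q ^ 2 := by
      rw [hwS]
      grind
    rw [hS] at h
    grind
  have eW2 : α * β * (Q ^ 2 * D w) =
      α * β * Q * D β + α * β * D Q * β + α * β * Q * S * D Q + Q * (Q * S + 1) * D (α * β) := by
    linear_combination α * β * eW + Q * eS -
      (α * β * Q * S * D Q + Q * (Q * S + 1) * D (α * β)) * h2
  -- This is the Riccati equation for `w`, up to the factor `Q²`; `S` has cancelled.
  have key : (α + β) * (α * β * (Q ^ 2 * D w)) + D (α * β * (α + β)) * (Q ^ 2 * (w ^ 2 + w)) =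
      Q ^ 2 * D (α * β) := by
    rw [eW2, eWW, hG, hDQ, hp, hQe]
    grind
  refine mul_left_cancel₀ (mul_ne_zero (pow_ne_zero 2 hQ) (pow_ne_zero 2 hw)) ?_
  rw [hmul _ x]
  linear_combination key + Q ^ 2 * (α * β * (α + β)) * eX - Q ^ 2 * D (α * β) * eX2 +
    Q ^ 2 * D (α * β * (α + β)) * w * hx - Q ^ 2 * D (α * β) * w ^ 2 * h2

lemma xi_riccati (ha : 1 ≤ a.natDegree) (hb : 1 ≤ b.natDegree)
    (hS : Tendsto (sigmaSum (ofPoly _ a) (ofPoly _ b)) atTop (𝓝 S)) :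
    zDeriv (ofPoly _ (a * b * (a + b)) * xi a b) =
      zDeriv (ofPoly _ (a * b)) * (1 + xi a b ^ 2) := by
  have hw := auxW_ne_zero ha hb hS
  have hquart := quartic_of_tendsto hS
  have hab := mul_ne_zero (ofPoly_ne_zero (Polynomial.ne_zero_of_natDegree_gt ha))
    (ofPoly_ne_zero (Polynomial.ne_zero_of_natDegree_gt hb))
  have hQ := ofPoly_ne_zero (mul_add_add_ne_zero ha hb)
  have hwe : auxW a b S = _ := auxW.eq_1 a b S
  have hx : xi a b * auxW a b S = auxW a b S + 1 := by
    rw [xi_eq ha hb hS]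
    field_simp
  simp only [map_mul, map_add] at *
  refine riccati_field zDeriv zDeriv_add zDeriv_mul (S := S) hQ hw ?_ ?_ hx
  · generalize ofPoly (ZMod 2) a * ofPoly (ZMod 2) b + ofPoly (ZMod 2) a + ofPoly (ZMod 2) b = Q at *
    generalize ofPoly (ZMod 2) a * ofPoly (ZMod 2) b = P at *
    have h2 : (2 : (ZMod 2)⸨X⸩) = 0 := CharTwo.two_eq_zero
    field_simp at hquart
    linear_combination -hquart - P * h2
  · rw [hwe]
    generalize ofPoly (ZMod 2) a * ofPoly (ZMod 2) b + ofPoly (ZMod 2) a + ofPoly (ZMod 2) b = Q at *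
    field_simp

/-! ### Irrationality and failure of hyperquadraticity. -/

/-- The coefficient `ρ = ab / (ab + a + b)` of the quartic `S⁴ = ρ (S + 1 / (ab + a + b))`. -/
def rho (a b : (ZMod 2)[X]) : (ZMod 2)⸨X⸩ := ofPoly _ (a * b) / ofPoly _ (a * b + a + b)

lemma rho_mem_rationals : rho a b ∈ rationals (ZMod 2) :=
  div_mem (ofPoly_mem_rationals _) (ofPoly_mem_rationals _)

lemma monic_of_ne_zero {P : (ZMod 2)[X]} (hP : P ≠ 0) : P.Monic := by
  have h : ∀ c : ZMod 2, c ≠ 0 → c = 1 := by decide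
  exact h _ (Polynomial.leadingCoeff_ne_zero.2 hP)

/-- If `ρ ^ n = 1` with `n ≠ 0`, then `ab` and `ab + a + b` divide each other; nonzero polynomials
over `𝔽₂` are monic, so they are equal and `a = b`. -/
lemma rho_pow_injective (ha : 1 ≤ a.natDegree) (hb : 1 ≤ b.natDegree) (hab : a ≠ b) :
    Function.Injective (fun n : ℕ ↦ rho a b ^ n) := by
  have hQ := mul_add_add_ne_zero ha hb
  have hP : a * b ≠ 0 := mul_ne_zero (Polynomial.ne_zero_of_natDegree_gt ha)
    (Polynomial.ne_zero_of_natDegree_gt hb)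
  have hρ : rho a b ≠ 0 := div_ne_zero (ofPoly_ne_zero hP) (ofPoly_ne_zero hQ)
  have hone (n : ℕ) (hn : n ≠ 0) : rho a b ^ n ≠ 1 := by
    intro h
    rw [rho, div_pow, div_eq_one_iff_eq (pow_ne_zero _ (ofPoly_ne_zero hQ)), ← map_pow,
      ← map_pow] at h
    have h' := ofPoly_injective h
    have h1 : a * b ∣ a * b + a + b := (IsIntegrallyClosed.pow_dvd_pow_iff hn).1 h'.dvd
    have h2 : a * b + a + b ∣ a * b := (IsIntegrallyClosed.pow_dvd_pow_iff hn).1 h'.symm.dvd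
    have h3 : a * b = a * b + a + b := Polynomial.eq_of_monic_of_associated (monic_of_ne_zero hP)
      (monic_of_ne_zero hQ) (associated_of_dvd_dvd h1 h2)
    rw [add_assoc, left_eq_add] at h3
    exact hab (CharTwo.add_eq_zero.1 h3)
  have hlt (m n : ℕ) (hmn : m < n) : rho a b ^ m ≠ rho a b ^ n := by
    intro h
    refine hone (n - m) (by omega) ?_
    rw [← Nat.add_sub_cancel' hmn.le, pow_add] at h
    exact (left_eq_mul₀ (pow_ne_zero _ hρ)).1 h
  intro m n h
  by_contra hmn
  rcases lt_or_gt_of_ne hmn with hmn | hmn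
  · exact hlt _ _ hmn h
  · exact hlt _ _ hmn h.symm

lemma limit_pow_four (hS : Tendsto (sigmaSum (ofPoly _ a) (ofPoly _ b)) atTop (𝓝 S))
    (hQ : a * b + a + b ≠ 0) (hP : a * b ≠ 0) :
    S ^ 4 = rho a b * S + rho a b / ofPoly _ (a * b + a + b) := by
  have h2 : (2 : (ZMod 2)⸨X⸩) = 0 := CharTwo.two_eq_zero
  have hquart := quartic_of_tendsto hS
  have hQ' := ofPoly_ne_zero hQ
  have hP' := ofPoly_ne_zero hP
  rw [rho]
  generalize ofPoly (ZMod 2) (a * b + a + b) = Q at *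
  generalize ofPoly (ZMod 2) (a * b) = P at *
  field_simp at hquart ⊢
  linear_combination -hquart - P * h2

/-- The iterates of the quartic relation. -/
lemma limit_pow_four_pow (hS : Tendsto (sigmaSum (ofPoly _ a) (ofPoly _ b)) atTop (𝓝 S))
    (hQ : a * b + a + b ≠ 0) (hP : a * b ≠ 0) (m : ℕ) :
    ∃ e : ℕ, 3 * e + 1 = 4 ^ m ∧ ∃ g ∈ rationals (ZMod 2), S ^ 4 ^ m = rho a b ^ e * S + g := by
  induction m with
  | zero => exact ⟨0, rfl, 0, zero_mem _, by simp⟩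
  | succ m ih =>
    obtain ⟨e, he, g, hg, h⟩ := ih
    refine ⟨4 * e + 1, by rw [pow_succ, ← he]; ring,
      rho a b ^ (4 * e) * (rho a b / ofPoly _ (a * b + a + b)) + g ^ 4, ?_, ?_⟩
    · exact add_mem (mul_mem (pow_mem rho_mem_rationals _)
        (div_mem rho_mem_rationals (ofPoly_mem_rationals _))) (pow_mem hg 4)
    · rw [pow_succ, pow_mul, h, show (4 : ℕ) = 2 ^ 2 by norm_num, add_pow_char_pow, mul_pow,
        ← show (4 : ℕ) = 2 ^ 2 by norm_num, limit_pow_four hS hQ hP]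
      ring

/-- Frobenius acts termwise on `w = c + S + S²`. For even `s` the exponents are `2e` and `e`; for
odd `s` the image of `S²` drops back to degree 1 in `S`, giving `2e` and `4e + 1`. -/
lemma auxW_pow_two_pow (hS : Tendsto (sigmaSum (ofPoly _ a) (ofPoly _ b)) atTop (𝓝 S))
    (hQ : a * b + a + b ≠ 0) (hP : a * b ≠ 0) {s : ℕ} (hs : 1 ≤ s) :
    ∃ i j : ℕ, i ≠ j ∧ ∃ g ∈ rationals (ZMod 2),
      auxW a b S ^ 2 ^ s = rho a b ^ i * S ^ 2 + rho a b ^ j * S + g := by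
  set c : (ZMod 2)⸨X⸩ := 1 + ofPoly _ b / ofPoly _ (a * b + a + b) with hc
  have hcmem : c ∈ rationals (ZMod 2) :=
    add_mem (one_mem _) (div_mem (ofPoly_mem_rationals _) (ofPoly_mem_rationals _))
  have hw : auxW a b S = c + S + S ^ 2 := rfl
  obtain ⟨m, rfl | rfl⟩ := s.even_or_odd'
  · obtain ⟨e, he, g, hg, h⟩ := limit_pow_four_pow hS hQ hP m
    -- Here `s ≥ 1` is needed: for `s = 0` the exponents `2e` and `e` would coincide.
    have he0 : e ≠ 0 := by
      rintro rfl
      have : 1 < 4 ^ m := Nat.one_lt_pow (by omega) (by norm_num)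
      omega
    refine ⟨2 * e, e, by omega, c ^ 2 ^ (2 * m) + g + g ^ 2,
      add_mem (add_mem (pow_mem hcmem _) hg) (pow_mem hg 2), ?_⟩
    rw [hw, add_pow_char_pow, add_pow_char_pow, pow_right_comm S, pow_mul 2 2 m,
      show 2 ^ 2 = 4 by norm_num, h, CharTwo.add_sq]
    ring
  · obtain ⟨e, he, g, hg, h⟩ := limit_pow_four_pow hS hQ hP m
    refine ⟨2 * e, 4 * e + 1, by omega, c ^ 2 ^ (2 * m + 1) + g ^ 2 + g ^ 4 +
      rho a b ^ (4 * e) * (rho a b / ofPoly _ (a * b + a + b)), ?_, ?_⟩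
    · exact add_mem (add_mem (add_mem (pow_mem hcmem _) (pow_mem hg 2)) (pow_mem hg 4))
        (mul_mem (pow_mem rho_mem_rationals _)
          (div_mem rho_mem_rationals (ofPoly_mem_rationals _)))
    · have h1 : S ^ 2 ^ (2 * m + 1) = rho a b ^ (2 * e) * S ^ 2 + g ^ 2 := by
        rw [pow_succ, pow_mul 2 2 m, pow_mul S, show 2 ^ 2 = 4 by norm_num, h, CharTwo.add_sq]
        ring
      rw [hw, add_pow_char_pow, add_pow_char_pow, pow_right_comm S, h1, CharTwo.add_sq, mul_pow,
        ← pow_mul S, limit_pow_four hS hQ hP]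
      ring

lemma xi_irrational (ha : 1 ≤ a.natDegree) (hb : 1 ≤ b.natDegree)
    (hS : Tendsto (sigmaSum (ofPoly _ a) (ofPoly _ b)) atTop (𝓝 S)) : ¬ IsRational (xi a b) := by
  intro h
  have hw : auxW a b S ∈ rationals (ZMod 2) := by
    rw [← inv_mem_iff, ← add_sub_cancel_left 1 (auxW a b S)⁻¹, ← xi_eq ha hb hS]
    exact sub_mem (mem_rationals.2 h) (one_mem _)
  have h0 := cubic_eq_zero ha hb hS
    ![1 + ofPoly _ b / ofPoly _ (a * b + a + b) - auxW a b S, 1, 1, 0] ?_ ?_ 2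
  · exact one_ne_zero h0
  · intro i
    fin_cases i
    · exact sub_mem (add_mem (one_mem _)
        (div_mem (ofPoly_mem_rationals _) (ofPoly_mem_rationals _))) hw
    · exact one_mem _
    · exact one_mem _
    · exact zero_mem _
  · simp only [Matrix.cons_val, auxW]
    ring

lemma xi_not_hyperquadratic (ha : 1 ≤ a.natDegree) (hb : 1 ≤ b.natDegree) (hab : a ≠ b)
    (hS : Tendsto (sigmaSum (ofPoly _ a) (ofPoly _ b)) atTop (𝓝 S)) :
    ¬ IsHyperquadratic 2 (xi a b) := by
  rintro ⟨-, s, hs, A, B, C, D, hdet, hden, hx⟩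
  have h2 : (2 : (ZMod 2)⸨X⸩) = 0 := CharTwo.two_eq_zero
  have hQ := mul_add_add_ne_zero ha hb
  have hP : a * b ≠ 0 := mul_ne_zero (Polynomial.ne_zero_of_natDegree_gt ha)
    (Polynomial.ne_zero_of_natDegree_gt hb)
  have hw := auxW_ne_zero ha hb hS
  obtain ⟨i, j, hij, g, hg, hW⟩ := auxW_pow_two_pow hS hQ hP hs
  have hW0 := pow_ne_zero (2 ^ s) hw
  rw [eq_div_iff hden, xi_eq ha hb hS, add_pow_char_pow, one_pow, inv_pow] at hx
  have hwe : auxW a b S = _ := auxW.eq_1 a b S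
  generalize auxW a b S ^ 2 ^ s = W at *
  generalize auxW a b S = w at *
  have hS4 := limit_pow_four hS hQ hP
  -- The Möbius relation rewritten through `ξ = 1 + 1 / w` and `ξ ^ 2 ^ s = 1 + 1 / W`; the change
  -- of variable preserves the determinant.
  have hlin : ofPoly _ (A + B + C + D) * (w * W) + ofPoly _ (A + C) * w + ofPoly _ (C + D) * W +
      ofPoly _ C = 0 := by
    simp only [map_add]
    field_simp at hx
    linear_combination hx + (w * W * (ofPoly _ A + ofPoly _ B) + ofPoly _ A * w) * h2
  have hdet' : ofPoly _ (C + D) * ofPoly _ (A + C) - ofPoly _ (A + B + C + D) * ofPoly _ C ≠ 0 := by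
    rw [← map_mul, ← map_mul, ← map_sub]
    convert ofPoly_ne_zero hdet using 2
    ring
  have hne : rho a b ^ i ≠ rho a b ^ j := fun h ↦ hij (rho_pow_injective ha hb hab h)
  have hmu := pow_mem (rho_mem_rationals (a := a) (b := b)) j
  have hla := pow_mem (rho_mem_rationals (a := a) (b := b)) i
  have hρ := rho_mem_rationals (a := a) (b := b)
  have hp := ofPoly_mem_rationals (A + B + C + D)
  have hq := ofPoly_mem_rationals (A + C)
  have hr := ofPoly_mem_rationals (C + D)
  have ht := ofPoly_mem_rationals C
  have hu : (ofPoly (ZMod 2) (a * b + a + b))⁻¹ ∈ rationals (ZMod 2) :=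
    inv_mem (ofPoly_mem_rationals _)
  have hc : 1 + ofPoly (ZMod 2) b / ofPoly (ZMod 2) (a * b + a + b) ∈ rationals (ZMod 2) :=
    add_mem (one_mem _) (div_mem (ofPoly_mem_rationals _) (ofPoly_mem_rationals _))
  rw [div_eq_mul_inv (rho a b)] at hS4
  generalize 1 + ofPoly (ZMod 2) b / ofPoly (ZMod 2) (a * b + a + b) = c at *
  generalize (ofPoly (ZMod 2) (a * b + a + b))⁻¹ = u at *
  generalize rho a b ^ i = l at *
  generalize rho a b ^ j = μ at *
  generalize rho a b = ρ at *
  generalize ofPoly (ZMod 2) (A + B + C + D) = p at *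
  generalize ofPoly (ZMod 2) (A + C) = q at *
  generalize ofPoly (ZMod 2) (C + D) = r at *
  generalize ofPoly (ZMod 2) C = t at *
  -- These are the coefficients of the relation in `S` after `S⁴ = ρ S + ρ u`. The cubic one forces
  -- `p = 0`; then `q + r μ = q + r l = 0` forces `r = 0`, so the determinant vanishes.
  have hcoef := cubic_eq_zero ha hb hS ![p * (c * g + l * ρ * u) + q * c + r * g + t,
    p * (g + c * μ + l * ρ) + q + r * μ, p * (g + μ + c * l) + q + r * l, p * (l + μ)] ?_ ?_
  · have h3 : p * (l + μ) = 0 := hcoef 3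
    have hlμ : l + μ ≠ 0 := fun h ↦ hne (CharTwo.add_eq_zero.1 h)
    have hp0 : p = 0 := (mul_eq_zero_iff_right hlμ).1 h3
    have h1 : p * (g + c * μ + l * ρ) + q + r * μ = 0 := hcoef 1
    have h2' : p * (g + μ + c * l) + q + r * l = 0 := hcoef 2
    have hr0 : r = 0 := by
      refine (mul_eq_zero_iff_right hlμ).1 ?_
      linear_combination h1 + h2' - (q + p * g) * h2 - (c * μ + l * ρ + μ + c * l) * hp0
    exact hdet' (by rw [hr0, hp0]; ring)
  · intro i
    fin_cases i
    · exact add_mem (add_mem (add_mem (mul_mem hp (add_mem (mul_mem hc hg)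
        (mul_mem (mul_mem hla hρ) hu))) (mul_mem hq hc)) (mul_mem hr hg)) ht
    · exact add_mem (add_mem (mul_mem hp (add_mem (add_mem hg (mul_mem hc hmu))
        (mul_mem hla hρ))) hq) (mul_mem hr hmu)
    · exact add_mem (add_mem (mul_mem hp (add_mem (add_mem hg hmu) (mul_mem hc hla))) hq)
        (mul_mem hr hla)
    · exact mul_mem hp (add_mem hla hmu)
  · simp only [Matrix.cons_val]
    rw [hwe, hW] at hlin
    linear_combination hlin - p * l * hS4

end

end ThueMorseCF

theorem proposition1 (a b : Polynomial (ZMod 2)) (ha : 1 ≤ a.natDegree) (hb : 1 ≤ b.natDegree)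
    (hab : a ≠ b) :
    -- the infinite continued fraction converges, so that `ξ` is its value
    Tendsto (ThueMorseCF.convergent a b) atTop (𝓝 (ThueMorseCF.xi a b)) ∧
    -- the Riccati equation
    ThueMorseCF.IsDifferentialQuadratic (ThueMorseCF.xi a b) ∧
    ThueMorseCF.zDeriv
        (ThueMorseCF.ofPoly (ZMod 2) (a * b * (a + b)) * ThueMorseCF.xi a b) =
      ThueMorseCF.zDeriv (ThueMorseCF.ofPoly (ZMod 2) (a * b)) *
        (1 + ThueMorseCF.xi a b ^ 2) ∧
    -- `ξ` is irrational and not hyperquadratic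
    ¬ ThueMorseCF.IsRational (ThueMorseCF.xi a b) ∧
    ¬ ThueMorseCF.IsHyperquadratic 2 (ThueMorseCF.xi a b) := by
  obtain ⟨S, hS⟩ := ThueMorseCF.exists_tendsto_sigmaSum ha hb
  have hric := ThueMorseCF.xi_riccati ha hb hS
  refine ⟨ThueMorseCF.tendsto_convergent ha hb, ?_, hric, ThueMorseCF.xi_irrational ha hb hS,
    ThueMorseCF.xi_not_hyperquadratic ha hb hab hS⟩
  have hG : a * b * (a + b) ≠ 0 :=
    mul_ne_zero (mul_ne_zero (Polynomial.ne_zero_of_natDegree_gt ha)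
      (Polynomial.ne_zero_of_natDegree_gt hb)) fun h ↦ hab (CharTwo.add_eq_zero.1 h)
  obtain ⟨G', hG'⟩ := ThueMorseCF.exists_zDeriv_ofPoly (a * b * (a + b))
  obtain ⟨P', hP'⟩ := ThueMorseCF.exists_zDeriv_ofPoly (a * b)
  rw [ThueMorseCF.zDeriv_mul, hG', hP'] at hric
  -- Expanding `(G ξ)'` with `G = ab(a + b)` and dividing by `G`, nonzero because `a ≠ b`, gives the
  -- coefficients `P'/G`, `-G'/G`, `P'/G`.
  refine ⟨_, _, _, ⟨P', _, hG, rfl⟩, ⟨-G', _, hG, rfl⟩, ⟨P', _, hG, rfl⟩, ?_⟩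
  have hG0 := ThueMorseCF.ofPoly_ne_zero hG
  rw [map_neg]
  field_simp
  linear_combination hric
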